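/- For a positive integer $m$ write $[m]=\{1,\dots,m\}$, and $[0]=\varnothing$; functions and partial functions are composed from right to left. Let $C_m$ (the Catalan monoid) be the monoid, under composition, of all functions $f:[m]\to[m]$ that are order-preserving ($i\le j$ implies $f(i)\le f(j)$) and order-increasing ($i\le f(i)$ for all $i\in[m]$). Let $IC_n$ be the monoid, under composition of partial functions, of all partial permutations $\theta$ of $[n]$ (injective partial functions $[n]\to[n]$, including the empty one) that are order-preserving ($\theta(i)<\theta(j)$ whenever $i<j$ lie in the domain of $\theta$) and order-increasing ($i\le\theta(i)$ for every $i$ in the domain of $\theta$). For a monoid $M$ and a field $\Bbbk$, let $\Bbbk M$ denote the monoid algebra, i.e. the $\Bbbk$-vector space with basis $M$ whose multiplication is the bilinear extension of that of $M$. Then for every field $\Bbbk$ and every integer $n\ge 0$ there is an isomorphism of $\Bbbk$-algebras $$\Bbbk C_{n+1}\;\cong\;\Bbbk\, IC_n .$$ -/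

import Mathlib

/-- The Catalan monoid `C_n`: the submonoid of the full transformation monoid on the `n`-element
chain (functions composed right to left) that consists of the order-preserving and
order-increasing functions. -/
def CatalanMonoid (n : ℕ) : Submonoid (Function.End (Fin n)) where
  carrier := {f | (∀ i j, i ≤ j → f i ≤ f j) ∧ ∀ i, i ≤ f i}
  one_mem' := ⟨fun _ _ h => h, fun _ => le_refl _⟩
  mul_mem' := fun {_ g} hf hg =>
    ⟨fun i j h => hf.1 _ _ (hg.1 i j h), fun i => le_trans (hg.2 i) (hf.2 (g i))⟩

/-- The symmetric inverse monoid `IS_n`: all partial permutations of the `n`-element chain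
(bijections from a subset onto a subset). -/
def SymInvMonoid (n : ℕ) : Type := Fin n ≃. Fin n

namespace SymInvMonoid

/-- `θ.Maps i a` says that `i` is in the domain of `θ` and `θ(i) = a`. -/
def Maps {n : ℕ} (θ : SymInvMonoid n) (i a : Fin n) : Prop := θ.toFun i = some a

/-- The product is composition of partial functions, right to left: in `θ * τ`, first apply `τ`,
then `θ`. -/
instance (n : ℕ) : Monoid (SymInvMonoid n) where
  mul θ τ := PEquiv.trans τ θ
  one := PEquiv.refl (Fin n)
  mul_assoc a b c := (PEquiv.trans_assoc c b a).symm
  one_mul a := PEquiv.trans_refl a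
  mul_one a := PEquiv.refl_trans a

theorem maps_one {n : ℕ} {i a : Fin n} : (1 : SymInvMonoid n).Maps i a ↔ i = a :=
  Option.some_inj

theorem maps_mul {n : ℕ} {θ τ : SymInvMonoid n} {i b : Fin n} :
    (θ * τ).Maps i b ↔ ∃ a, τ.Maps i a ∧ θ.Maps a b :=
  Option.bind_eq_some_iff

end SymInvMonoid

/-- The monoid `IO_n` of all order-preserving partial permutations: `θ(i) < θ(j)` whenever `i < j`
are in the domain of `θ`. -/
def IOMonoid (n : ℕ) : Submonoid (SymInvMonoid n) where
  carrier := {θ | ∀ i j a b, θ.Maps i a → θ.Maps j b → i < j → a < b}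
  one_mem' := by
    intro i j a b hi hj h
    rw [SymInvMonoid.maps_one] at hi hj
    exact hi ▸ hj ▸ h
  mul_mem' := by
    intro θ τ hθ hτ i j a b hi hj h
    obtain ⟨c, hc, hc'⟩ := SymInvMonoid.maps_mul.1 hi
    obtain ⟨d, hd, hd'⟩ := SymInvMonoid.maps_mul.1 hj
    exact hθ c d a b hc' hd' (hτ i j c d hc hd h)

/-- The monoid `IC_n` of all order-preserving and order-increasing partial permutations:
those `θ` in `IO_n` such that `i ≤ θ(i)` for every `i` in the domain of `θ`. -/
def ICMonoid (n : ℕ) : Submonoid (SymInvMonoid n) where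
  carrier := {θ | θ ∈ IOMonoid n ∧ ∀ i a, θ.Maps i a → i ≤ a}
  one_mem' := ⟨(IOMonoid n).one_mem, fun _ _ h => (SymInvMonoid.maps_one.1 h).le⟩
  mul_mem' := by
    intro θ τ hθ hτ
    refine ⟨(IOMonoid n).mul_mem hθ.1 hτ.1, fun i a h => ?_⟩
    obtain ⟨c, hc, hc'⟩ := SymInvMonoid.maps_mul.1 h
    exact (hτ.2 i c hc).trans (hθ.2 c a hc')

/-! Both monoids act on the space with basis the subsets of `Fin n`: a partial map sends `X` to its
image if it is defined and injective on `X`, and to 0 otherwise. For `CatalanMonoid (n + 1)`, the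
fixed top point is read as "undefined". A nonzero entry in position (Y, X) means that some θ in
`ICMonoid n` has domain X and range Y, and θ is determined by X and Y. So both images lie in the
span of the independent matrix units E_θ at (ran θ, dom θ). The matrices of θ and of `extend θ` both
equal E_θ plus units of smaller weight, the weight being the size of the domain for θ and the sum of
x + 1 over it for `extend θ`. By unitriangularity both representations of the monoid algebras are
faithful with that whole span as image, so the algebras are isomorphic. -/

/-! ### Linear algebra: unitriangular families and matrix units. -/

theorem MonoidAlgebra.injective_and_range_eq_span_of_unitriangular
    {k A M ι : Type*} [Field k] [Ring A] [Algebra k A] [Monoid M] [Finite ι]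
    (Φ : MonoidAlgebra k M →ₐ[k] A) (E : ι → A) (hE : LinearIndependent k E)
    (s : ι → M) (hs : Function.Surjective s) (d : ι → ℕ)
    (h : ∀ i, Φ (MonoidAlgebra.of k M (s i)) - E i ∈ Submodule.span k (E '' {j | d j < d i})) :
    Function.Injective Φ ∧ LinearMap.range Φ.toLinearMap = Submodule.span k (Set.range E) := by
  have hfin : Finite M := Finite.of_surjective s hs
  have hrange : LinearMap.range Φ.toLinearMap = Submodule.span k (Set.range E) := by
    apply le_antisymm
    · rintro _ ⟨x, rfl⟩
      induction x using MonoidAlgebra.induction_on with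
      | of m =>
        obtain ⟨i, rfl⟩ := hs m
        have h₁ := Submodule.span_mono (Set.image_subset_range _ _) (h i)
        have h₂ : E i ∈ Submodule.span k (Set.range E) := Submodule.subset_span ⟨i, rfl⟩
        simpa using add_mem h₁ h₂
      | add x y hx hy => rw [map_add]; exact add_mem hx hy
      | smul c x hx => rw [map_smul]; exact Submodule.smul_mem _ _ hx
    · rw [Submodule.span_le]
      rintro _ ⟨i, rfl⟩
      induction hi : d i using Nat.strong_induction_on generalizing i with
      | _ m ih =>
        have hle : Submodule.span k (E '' {j | d j < d i}) ≤ LinearMap.range Φ.toLinearMap := by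
          rw [Submodule.span_le]
          rintro _ ⟨j, hj, rfl⟩
          exact ih (d j) (hi ▸ hj) j rfl
        have h₂ : Φ (MonoidAlgebra.of k M (s i)) ∈ LinearMap.range Φ.toLinearMap := ⟨_, rfl⟩
        simpa using sub_mem h₂ (hle (h i))
  refine ⟨?_, hrange⟩
  -- Dimension count: the range has dimension |ι|, and |M| ≤ |ι| because `s` is onto, so the kernel
  -- is zero.
  have := Fintype.ofFinite M
  have := Fintype.ofFinite ι
  have hM : Module.finrank k (MonoidAlgebra k M) = Fintype.card M := by
    rw [(MonoidAlgebra.coeffLinearEquiv (S := k) (M := M) k).finrank_eq]; simp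
  have : Module.Finite k (MonoidAlgebra k M) :=
    Module.Finite.equiv (MonoidAlgebra.coeffLinearEquiv (S := k) (M := M) k).symm
  have hsum := Φ.toLinearMap.finrank_range_add_finrank_ker
  rw [hrange, finrank_span_eq_card hE, hM] at hsum
  have hcard := Fintype.card_le_of_surjective s hs
  have hker : Module.finrank k (LinearMap.ker Φ.toLinearMap) = 0 := by omega
  exact LinearMap.ker_eq_bot.1 (Submodule.finrank_eq_zero.1 hker)

theorem Matrix.mem_of_forall_single_mem {R m n : Type*} [CommSemiring R] [Fintype m] [Fintype n]
    [DecidableEq m] [DecidableEq n] (S : Submodule R (Matrix m n R)) (M : Matrix m n R)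
    (h : ∀ i j, M i j ≠ 0 → Matrix.single i j 1 ∈ S) : M ∈ S := by
  rw [Matrix.matrix_eq_sum_single M]
  refine sum_mem fun i _ => sum_mem fun j _ => ?_
  by_cases hij : M i j = 0
  · simp [hij]
  · have := S.smul_mem (M i j) (h i j hij)
    rwa [Matrix.smul_single, smul_eq_mul, mul_one] at this

/-! ### The action of partial maps on subsets. -/

/-- The partial map `p` restricts to a bijection from `X` onto `Y`. -/
def CarriesFinset {α : Type*} [DecidableEq α] (p : α → Option α) (X Y : Finset α) : Prop :=
  Set.InjOn p X ∧ X.image p = Y.image some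

namespace CarriesFinset

variable {α : Type*} [DecidableEq α] {p q : α → Option α} {X Y Z : Finset α}

theorem right_unique (h : CarriesFinset p X Y) (h' : CarriesFinset p X Z) : Y = Z :=
  Finset.image_injective (Option.some_injective _) (h.2.symm.trans h'.2)

theorem exists_of_mem (h : CarriesFinset p X Y) {x : α} (hx : x ∈ X) :
    ∃ y ∈ Y, p x = some y := by
  have := Finset.mem_image_of_mem p hx
  rw [h.2, Finset.mem_image] at this
  obtain ⟨y, hy, hyx⟩ := this
  exact ⟨y, hy, hyx.symm⟩

theorem exists_preimage (h : CarriesFinset p X Y) {y : α} (hy : y ∈ Y) :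
    ∃ x ∈ X, p x = some y := by
  have := Finset.mem_image_of_mem some hy
  rwa [← h.2, Finset.mem_image] at this

theorem of_forall (hp : Set.InjOn p X) (h : ∀ x ∈ X, ∃ y, p x = some y) :
    ∃ Y, CarriesFinset p X Y := by
  refine ⟨(X.image p).eraseNone, hp, ?_⟩
  ext z
  simp only [Finset.mem_image, Finset.mem_eraseNone]
  constructor
  · rintro ⟨x, hx, rfl⟩
    obtain ⟨y, hy⟩ := h x hx
    exact ⟨y, ⟨x, hx, hy⟩, hy.symm⟩
  · rintro ⟨y, hy, rfl⟩
    exact hy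

theorem some_iff : CarriesFinset some X Y ↔ X = Y :=
  ⟨fun h => Finset.image_injective (Option.some_injective _) h.2,
    fun h => ⟨(Option.some_injective _).injOn, h ▸ rfl⟩⟩

theorem trans (hp : CarriesFinset p X Y) (hq : CarriesFinset q Y Z) :
    CarriesFinset (fun i => (p i).bind q) X Z := by
  refine ⟨fun x hx x' hx' e => ?_, ?_⟩
  · obtain ⟨y, hy, e₁⟩ := hp.exists_of_mem hx
    obtain ⟨y', hy', e₂⟩ := hp.exists_of_mem hx'
    simp only [e₁, e₂, Option.bind_some] at e
    exact hp.1 hx hx' (by rw [e₁, e₂, hq.1 hy hy' e])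
  · have : X.image (fun i => (p i).bind q) = (X.image p).image (·.bind q) := by
      rw [Finset.image_image]; rfl
    rw [this, hp.2, ← hq.2, Finset.image_image]
    rfl

theorem of_bind (h : CarriesFinset (fun i => (p i).bind q) X Z) :
    ∃ Y, CarriesFinset p X Y ∧ CarriesFinset q Y Z := by
  have hinj : Set.InjOn p X := fun x hx x' hx' e => h.1 hx hx' (by simp only [e])
  obtain ⟨Y, hY⟩ := of_forall hinj fun x hx => by
    obtain ⟨z, -, hz⟩ := h.exists_of_mem hx
    obtain ⟨y, hy, -⟩ := Option.bind_eq_some_iff.1 hz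
    exact ⟨y, hy⟩
  refine ⟨Y, hY, fun y hy y' hy' e => ?_, ?_⟩
  · obtain ⟨x, hx, ex⟩ := hY.exists_preimage hy
    obtain ⟨x', hx', ex'⟩ := hY.exists_preimage hy'
    have := h.1 hx hx' (by simp only [ex, ex', Option.bind_some, e])
    subst this
    exact Option.some_injective _ (ex.symm.trans ex')
  · have : X.image (fun i => (p i).bind q) = (X.image p).image (·.bind q) := by
      rw [Finset.image_image]; rfl
    rw [← h.2, this, hY.2, Finset.image_image]
    rfl

end CarriesFinset

open Classical in
/-- The matrix of the action of a partial map on the finite subsets of its source, in which a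
subset on which the map is not injective, or not everywhere defined, is sent to zero. -/
noncomputable def partialMapMatrix (k : Type*) [Semiring k] {α : Type*} [DecidableEq α]
    (p : α → Option α) : Matrix (Finset α) (Finset α) k :=
  fun Y X => if CarriesFinset p X Y then 1 else 0

section partialMapMatrix

variable (k : Type*) [Semiring k] {α : Type*} [DecidableEq α]

theorem partialMapMatrix_apply (p : α → Option α) (X Y : Finset α)
    [Decidable (CarriesFinset p X Y)] :
    partialMapMatrix k p Y X = if CarriesFinset p X Y then 1 else 0 := by
  unfold partialMapMatrix
  convert rfl

theorem partialMapMatrix_some :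
    partialMapMatrix k (some : α → Option α) = 1 := by
  classical
  ext Y X
  rw [partialMapMatrix_apply, Matrix.one_apply]
  simp only [CarriesFinset.some_iff, eq_comm]

/-- A composite is defined and injective on X exactly when `p` is so on X and `q` on the image of X;
that image is the only index contributing to the matrix product. -/
theorem partialMapMatrix_bind [Fintype α] (p q : α → Option α) :
    partialMapMatrix k (fun i => (p i).bind q) = partialMapMatrix k q * partialMapMatrix k p := by
  classical
  ext Z X
  simp only [Matrix.mul_apply, partialMapMatrix_apply, mul_ite, mul_one, mul_zero]
  by_cases h : CarriesFinset (fun i => (p i).bind q) X Z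
  · obtain ⟨Y, hp, hq⟩ := h.of_bind
    rw [if_pos h, Finset.sum_eq_single Y]
    · rw [if_pos hp, if_pos hq]
    · intro Y' _ hne
      exact if_neg fun hp' => hne (hp'.right_unique hp)
    · simp
  · rw [if_neg h, Finset.sum_eq_zero]
    intro Y _
    split_ifs with hp hq
    · exact (h (hp.trans hq)).elim
    · rfl
    · rfl

end partialMapMatrix

theorem PEquiv.exists_forall_apply_eq {α β : Type*} (p : α → Option β)
    (hp : ∀ i j b, p i = some b → p j = some b → i = j) : ∃ θ : α ≃. β, ∀ i, θ i = p i := by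
  classical
  refine ⟨⟨p, fun b => if h : ∃ i, p i = some b then some h.choose else none, fun i b => ?_⟩,
    fun i => rfl⟩
  constructor
  · intro h
    split_ifs at h with hb
    obtain rfl := Option.some_injective _ h
    exact hb.choose_spec
  · intro h
    have hb : ∃ i, p i = some b := ⟨i, h⟩
    rw [dif_pos hb, hp _ _ _ hb.choose_spec h]

/-! ### Elements of `ICMonoid n` as pairs (domain, range). -/

/-- A partial map of a chain that is weakly order-preserving and order-increasing. -/
structure IsCatalanPartial {n : ℕ} (p : Fin n → Option (Fin n)) : Prop where
  monotone : ∀ {i j a b}, p i = some a → p j = some b → i ≤ j → a ≤ b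
  le_apply : ∀ {i a}, p i = some a → i ≤ a

namespace ICMonoid

variable {n : ℕ}

instance : Finite (ICMonoid n) :=
  have : Finite (SymInvMonoid n) :=
    Finite.of_injective (fun θ : SymInvMonoid n => PEquiv.toFun θ)
      fun _ _ h => DFunLike.coe_injective (F := Fin n ≃. Fin n) h
  Subtype.finite

/-- The partial map underlying an element of `ICMonoid n`. -/
def toPartial (θ : ICMonoid n) : Fin n → Option (Fin n) := PEquiv.toFun θ.1

theorem toPartial_injective : Function.Injective (toPartial (n := n)) := fun _ _ h =>
  Subtype.ext (DFunLike.coe_injective (F := Fin n ≃. Fin n) h)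

theorem toPartial_inj (θ : ICMonoid n) {i j a : Fin n} (hi : toPartial θ i = some a)
    (hj : toPartial θ j = some a) : i = j :=
  PEquiv.inj (show Fin n ≃. Fin n from θ.1) hi hj

theorem strictMono (θ : ICMonoid n) {i j a b : Fin n} (hi : toPartial θ i = some a)
    (hj : toPartial θ j = some b) (h : i < j) : a < b :=
  θ.2.1 i j a b hi hj h

theorem isCatalanPartial (θ : ICMonoid n) : IsCatalanPartial (toPartial θ) where
  monotone {i j a b} hi hj h := by
    rcases h.eq_or_lt with rfl | h
    · exact (Option.some_injective _ (hi.symm.trans hj)).le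
    · exact (strictMono θ hi hj h).le
  le_apply h := θ.2.2 _ _ h

/-- The domain of a partial permutation. -/
def dom (θ : ICMonoid n) : Finset (Fin n) := {i | ∃ a, toPartial θ i = some a}

/-- The range of a partial permutation. -/
def ran (θ : ICMonoid n) : Finset (Fin n) := {a | ∃ i, toPartial θ i = some a}

theorem mem_dom {θ : ICMonoid n} {i : Fin n} : i ∈ dom θ ↔ ∃ a, toPartial θ i = some a := by
  simp [dom]

theorem mem_ran {θ : ICMonoid n} {a : Fin n} : a ∈ ran θ ↔ ∃ i, toPartial θ i = some a := by
  simp [ran]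

theorem eq_none_of_notMem_dom {θ : ICMonoid n} {i : Fin n} (h : i ∉ dom θ) :
    toPartial θ i = none := by
  rw [Option.eq_none_iff_forall_ne_some]
  exact fun a ha => h (mem_dom.2 ⟨a, ha⟩)

theorem carriesFinset (θ : ICMonoid n) {p : Fin n → Option (Fin n)}
    (hp : ∀ i ∈ dom θ, p i = toPartial θ i) : CarriesFinset p (dom θ) (ran θ) := by
  refine ⟨fun i hi j hj e => ?_, ?_⟩
  · rw [hp i hi, hp j hj] at e
    obtain ⟨a, ha⟩ := mem_dom.1 hi
    exact toPartial_inj θ ha (e ▸ ha)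
  · ext z
    simp only [Finset.mem_image, mem_ran]
    constructor
    · rintro ⟨i, hi, rfl⟩
      obtain ⟨a, ha⟩ := mem_dom.1 hi
      exact ⟨a, ⟨i, ha⟩, by rw [hp i hi, ha]⟩
    · rintro ⟨a, ⟨i, hi⟩, rfl⟩
      have := mem_dom.2 ⟨a, hi⟩
      exact ⟨i, this, by rw [hp i this, hi]⟩

/-- A strictly increasing function on a finite chain is determined by its range. -/
theorem eq_of_dom_eq_of_ran_eq {θ τ : ICMonoid n} (hd : dom θ = dom τ) (hr : ran θ = ran τ) :
    θ = τ := by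
  have key : ∀ σ : ICMonoid n, dom σ = dom θ → ran σ = ran θ →
      ∃ f : {i // i ∈ dom θ} → Fin n, StrictMono f ∧ Set.range f = ran θ ∧
        ∀ x : {i // i ∈ dom θ}, toPartial σ x = some (f x) := by
    intro σ hd hr
    have (x : {i // i ∈ dom θ}) : ∃ a, toPartial σ x = some a := mem_dom.1 (by rw [hd]; exact x.2)
    choose f hf using this
    refine ⟨f, fun x y h => strictMono σ (hf x) (hf y) h, ?_, hf⟩
    ext a
    rw [Finset.mem_coe, ← hr, mem_ran]
    constructor
    · rintro ⟨x, rfl⟩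
      exact ⟨x, hf x⟩
    · rintro ⟨i, hi⟩
      have hi' : i ∈ dom θ := hd ▸ mem_dom.2 ⟨a, hi⟩
      exact ⟨⟨i, hi'⟩, Option.some_injective _ ((hf ⟨i, hi'⟩).symm.trans hi)⟩
  obtain ⟨f, hf, hfr, hfθ⟩ := key θ rfl rfl
  obtain ⟨g, hg, hgr, hgτ⟩ := key τ hd.symm hr.symm
  have hfg : f = g := (StrictMono.range_inj hf hg).1 (hfr.trans hgr.symm)
  subst hfg
  refine toPartial_injective (funext fun i => ?_)
  by_cases hi : i ∈ dom θ
  · exact (hfθ ⟨i, hi⟩).trans (hgτ ⟨i, hi⟩).symm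
  · rw [eq_none_of_notMem_dom hi, eq_none_of_notMem_dom (hd ▸ hi)]

/-- Weakly monotone and injective on X gives strictly monotone on X. This locates the possible
nonzero matrix entries. -/
theorem exists_restrict {p : Fin n → Option (Fin n)} (hp : IsCatalanPartial p)
    {X Y : Finset (Fin n)} (h : CarriesFinset p X Y) :
    ∃ θ : ICMonoid n, dom θ = X ∧ ran θ = Y ∧ ∀ i ∈ X, toPartial θ i = p i := by
  obtain ⟨θ, hθ⟩ := PEquiv.exists_forall_apply_eq (fun i => if i ∈ X then p i else none) (by
    intro i j b hi hj
    split_ifs at hi hj with hiX hjX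
    exact h.1 hiX hjX (hi.trans hj.symm))
  have hmaps {i a : Fin n} : θ i = some a ↔ i ∈ X ∧ p i = some a := by
    rw [hθ]; split_ifs with hi <;> simp [hi]
  let σ : ICMonoid n := ⟨θ, by
    refine ⟨fun i j a b hi hj hij => ?_, fun i a hi => ?_⟩
    · obtain ⟨hiX, hi⟩ := hmaps.1 hi
      obtain ⟨hjX, hj⟩ := hmaps.1 hj
      refine (hp.monotone hi hj hij.le).lt_of_ne ?_
      rintro rfl
      exact hij.ne (h.1 hiX hjX (hi.trans hj.symm))
    · exact hp.le_apply (hmaps.1 hi).2⟩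
  have hσ {i a : Fin n} : toPartial σ i = some a ↔ i ∈ X ∧ p i = some a := hmaps
  have hdom : dom σ = X := by
    ext i
    simp only [mem_dom, hσ]
    constructor
    · rintro ⟨a, hi, -⟩
      exact hi
    · intro hi
      obtain ⟨a, -, ha⟩ := h.exists_of_mem hi
      exact ⟨a, hi, ha⟩
  have heq : ∀ i ∈ X, toPartial σ i = p i := fun i hi => by
    obtain ⟨a, -, ha⟩ := h.exists_of_mem hi
    rw [ha, hσ]
    exact ⟨hi, ha⟩
  have hc := carriesFinset σ (p := p) fun i hi => (heq i (hdom ▸ hi)).symm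
  rw [hdom] at hc
  exact ⟨σ, hdom, hc.right_unique h, heq⟩

end ICMonoid

/-! ### The representation of `ICMonoid n` and its image. -/

namespace ICMonoid

variable {n : ℕ} (k : Type*) [Field k]

/-- The matrix unit in the position given by the domain and the range of `θ`. -/
def matrixUnit (θ : ICMonoid n) : Matrix (Finset (Fin n)) (Finset (Fin n)) k :=
  Matrix.single (ran θ) (dom θ) 1

theorem linearIndependent_matrixUnit : LinearIndependent k (matrixUnit (n := n) k) := by
  have hinj : Function.Injective fun θ : ICMonoid n => (ran θ, dom θ) := fun θ τ h =>
    eq_of_dom_eq_of_ran_eq (Prod.ext_iff.1 h).2 (Prod.ext_iff.1 h).1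
  have := (Matrix.stdBasis k (Finset (Fin n)) (Finset (Fin n))).linearIndependent.comp _ hinj
  convert this using 1
  ext1 θ
  exact (Matrix.stdBasis_eq_single k (ran θ) (dom θ)).symm

/-- Column `dom θ` has a single nonzero entry, in row `ran θ`, which E_θ cancels. A nonzero entry in
any other column is the position of a restriction of `p`, of smaller weight by `hd`. -/
theorem partialMapMatrix_sub_matrixUnit_mem {p : Fin n → Option (Fin n)}
    (hp : IsCatalanPartial p) (θ : ICMonoid n) (hθ : ∀ i ∈ dom θ, p i = toPartial θ i)
    (d : Finset (Fin n) → ℕ)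
    (hd : ∀ X Y, CarriesFinset p X Y → X ≠ dom θ → d X < d (dom θ)) :
    partialMapMatrix k p - matrixUnit k θ ∈
      Submodule.span k (matrixUnit k '' {τ | d (dom τ) < d (dom θ)}) := by
  classical
  refine Matrix.mem_of_forall_single_mem _ _ fun Y X hYX => ?_
  rw [Matrix.sub_apply, partialMapMatrix_apply, matrixUnit, Matrix.single_apply] at hYX
  have hc := carriesFinset θ hθ
  by_cases hXY : CarriesFinset p X Y
  · obtain ⟨τ, rfl, rfl, -⟩ := exists_restrict hp hXY
    refine Submodule.subset_span ⟨τ, hd _ _ hXY fun h => hYX ?_, rfl⟩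
    rw [h] at hXY ⊢
    simp [hXY, hc.right_unique hXY]
  · refine (hYX ?_).elim
    rw [if_neg hXY, if_neg, sub_zero]
    rintro ⟨rfl, rfl⟩
    exact hXY hc

/-- The representation of `ICMonoid n` on the finite subsets of the chain. -/
noncomputable def matrixHom : ICMonoid n →* Matrix (Finset (Fin n)) (Finset (Fin n)) k where
  toFun θ := partialMapMatrix k (toPartial θ)
  map_one' := partialMapMatrix_some k
  map_mul' θ τ := partialMapMatrix_bind k (toPartial τ) (toPartial θ)

theorem lift_matrixHom_injective_and_range_eq :
    Function.Injective (MonoidAlgebra.lift k _ (ICMonoid n) (matrixHom k)) ∧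
      LinearMap.range (MonoidAlgebra.lift k _ (ICMonoid n) (matrixHom k)).toLinearMap =
        Submodule.span k (Set.range (matrixUnit (n := n) k)) := by
  refine MonoidAlgebra.injective_and_range_eq_span_of_unitriangular _ _
    (linearIndependent_matrixUnit k) id Function.surjective_id (fun θ => (dom θ).card)
    fun θ => ?_
  rw [MonoidAlgebra.lift_of]
  refine partialMapMatrix_sub_matrixUnit_mem k (isCatalanPartial θ) θ (fun _ _ => rfl)
    Finset.card fun X Y h hne => Finset.card_lt_card (Finset.ssubset_iff_subset_ne.2 ⟨?_, hne⟩)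
  intro i hi
  obtain ⟨a, -, ha⟩ := h.exists_of_mem hi
  exact mem_dom.2 ⟨a, ha⟩

end ICMonoid

/-! ### The representation of `CatalanMonoid (n + 1)` and its image. -/

namespace CatalanMonoid

variable {n : ℕ}

theorem map_last (f : CatalanMonoid (n + 1)) : f.1 (Fin.last n) = Fin.last n :=
  Fin.last_le_iff.1 (f.2.2 _)

/-- The partial map of `Fin n` obtained from an element of `CatalanMonoid (n + 1)` by regarding
the value `n` as undefined. -/
def toPartial (f : CatalanMonoid (n + 1)) (i : Fin n) : Option (Fin n) :=
  finSuccEquivLast (f.1 i.castSucc)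

theorem toPartial_eq_some {f : CatalanMonoid (n + 1)} {i a : Fin n} :
    toPartial f i = some a ↔ f.1 i.castSucc = a.castSucc := by
  rw [toPartial, ← Equiv.eq_symm_apply, finSuccEquivLast_symm_some]

theorem toPartial_one : toPartial (1 : CatalanMonoid (n + 1)) = some :=
  funext fun i => finSuccEquivLast_castSucc i

/-- Because the top point is fixed, a value once undefined stays undefined. -/
theorem toPartial_mul (f g : CatalanMonoid (n + 1)) :
    toPartial (f * g) = fun i => (toPartial g i).bind (toPartial f) := by
  funext i
  change finSuccEquivLast (f.1 (g.1 i.castSucc)) = (finSuccEquivLast (g.1 i.castSucc)).bind _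
  cases g.1 i.castSucc using Fin.lastCases with
  | last => rw [map_last, finSuccEquivLast_last]; rfl
  | cast j => rw [finSuccEquivLast_castSucc]; rfl

theorem isCatalanPartial (f : CatalanMonoid (n + 1)) : IsCatalanPartial (toPartial f) where
  monotone {i j a b} hi hj h := by
    rw [toPartial_eq_some] at hi hj
    rw [← Fin.castSucc_le_castSucc_iff, ← hi, ← hj]
    exact f.2.1 _ _ (Fin.castSucc_le_castSucc_iff.2 h)
  le_apply {i a} h := by
    rw [toPartial_eq_some] at h
    rw [← Fin.castSucc_le_castSucc_iff, ← h]
    exact f.2.2 _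

/-- The largest element of `CatalanMonoid (n + 1)` that extends `θ`: it sends `j` to the value of
`θ` at the least point of its domain that is at least `j`, and to `n` if there is none. -/
def extend (θ : ICMonoid n) : CatalanMonoid (n + 1) :=
  -- Points outside the domain contribute the top element, which is neutral for `inf` and is also
  -- the empty infimum.
  ⟨fun j => (Finset.univ.filter fun x : Fin n => j ≤ x.castSucc).inf
      fun x => finSuccEquivLast.symm (ICMonoid.toPartial θ x), by
    refine ⟨fun i j h => Finset.inf_mono fun x hx => ?_, fun i => Finset.le_inf fun x hx => ?_⟩
    · simp only [Finset.mem_filter, Finset.mem_univ, true_and] at hx ⊢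
      exact h.trans hx
    · simp only [Finset.mem_filter, Finset.mem_univ, true_and] at hx
      refine hx.trans ?_
      cases h : ICMonoid.toPartial θ x with
      | none => simpa using Fin.le_last _
      | some a =>
        rw [finSuccEquivLast_symm_some]
        exact Fin.castSucc_le_castSucc_iff.2 ((ICMonoid.isCatalanPartial θ).le_apply h)⟩

theorem extend_apply (θ : ICMonoid n) (j : Fin (n + 1)) :
    (extend θ).1 j = (Finset.univ.filter fun x : Fin n => j ≤ x.castSucc).inf
      fun x => finSuccEquivLast.symm (ICMonoid.toPartial θ x) := rfl

theorem extend_le {θ : ICMonoid n} {j : Fin (n + 1)} {x a : Fin n} (hj : j ≤ x.castSucc)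
    (hx : ICMonoid.toPartial θ x = some a) : (extend θ).1 j ≤ a.castSucc := by
  rw [extend_apply]
  refine (Finset.inf_le (b := x) (by simpa using hj)).trans ?_
  rw [hx, finSuccEquivLast_symm_some]

theorem exists_of_extend_eq {θ : ICMonoid n} {j : Fin (n + 1)} {a : Fin n}
    (h : (extend θ).1 j = a.castSucc) :
    ∃ x : Fin n, j ≤ x.castSucc ∧ ICMonoid.toPartial θ x = some a := by
  rw [extend_apply] at h
  have hne : (Finset.univ.filter fun x : Fin n => j ≤ x.castSucc).Nonempty := by
    rw [Finset.nonempty_iff_ne_empty]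
    intro he
    rw [he, Finset.inf_empty] at h
    exact (Fin.castSucc_lt_last a).ne h.symm
  obtain ⟨x, hx, hxe⟩ := Finset.exists_mem_eq_inf _ hne
    (fun x => finSuccEquivLast.symm (ICMonoid.toPartial θ x))
  refine ⟨x, by simpa using hx, ?_⟩
  rw [← finSuccEquivLast_symm_some] at h
  exact finSuccEquivLast.symm.injective (hxe.symm.trans h)

theorem toPartial_extend (θ : ICMonoid n) {x : Fin n} (hx : x ∈ ICMonoid.dom θ) :
    toPartial (extend θ) x = ICMonoid.toPartial θ x := by
  obtain ⟨a, ha⟩ := ICMonoid.mem_dom.1 hx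
  rw [ha, toPartial_eq_some]
  refine le_antisymm (extend_le le_rfl ha) ?_
  rw [extend_apply]
  refine Finset.le_inf fun y hy => ?_
  simp only [Finset.mem_filter, Finset.mem_univ, true_and, Fin.castSucc_le_castSucc_iff] at hy
  cases h : ICMonoid.toPartial θ y with
  | none => simpa using Fin.le_last _
  | some b =>
    rw [finSuccEquivLast_symm_some]
    exact Fin.castSucc_le_castSucc_iff.2 ((ICMonoid.isCatalanPartial θ).monotone ha h hy)

/-- Each x in X shares its value under `extend θ` with a point c x ≥ x of `dom θ`. Injectivity on X
makes c injective, so moving X up along c into `dom θ` cannot lower the sum. Cardinality alone would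
not do: X may have as many points as `dom θ`. -/
theorem sum_lt_of_carriesFinset_extend (θ : ICMonoid n) {X Y : Finset (Fin n)}
    (h : CarriesFinset (toPartial (extend θ)) X Y) (hne : X ≠ ICMonoid.dom θ) :
    ∑ x ∈ X, (x.1 + 1) < ∑ x ∈ ICMonoid.dom θ, (x.1 + 1) := by
  have hex : ∀ x : Fin n, ∃ c : Fin n, x ∈ X →
      x ≤ c ∧ ICMonoid.toPartial θ c = toPartial (extend θ) x ∧ c ∈ ICMonoid.dom θ := by
    intro x
    by_cases hx : x ∈ X
    · obtain ⟨a, -, ha⟩ := h.exists_of_mem hx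
      obtain ⟨c, hxc, hc⟩ := exists_of_extend_eq (toPartial_eq_some.1 ha)
      exact ⟨c, fun _ => ⟨Fin.castSucc_le_castSucc_iff.1 hxc, hc.trans ha.symm,
        ICMonoid.mem_dom.2 ⟨a, hc⟩⟩⟩
    · exact ⟨x, fun hx' => (hx hx').elim⟩
  choose c hc using hex
  have hinj : Set.InjOn c X := fun x hx y hy e =>
    h.1 hx hy ((hc x hx).2.1.symm.trans ((congrArg _ e).trans (hc y hy).2.1))
  have himage : X.image c ⊆ ICMonoid.dom θ := by
    intro y hy
    obtain ⟨x, hx, rfl⟩ := Finset.mem_image.1 hy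
    exact (hc x hx).2.2
  have hle : ∑ x ∈ X.image c, (x.1 + 1) ≤ ∑ x ∈ ICMonoid.dom θ, (x.1 + 1) :=
    Finset.sum_le_sum_of_subset himage
  rw [Finset.sum_image hinj] at hle
  by_cases hfix : ∀ x ∈ X, c x = x
  · have hX : X ⊂ ICMonoid.dom θ :=
      Finset.ssubset_iff_subset_ne.2 ⟨fun x hx => hfix x hx ▸ (hc x hx).2.2, hne⟩
    obtain ⟨y, hy, hyX⟩ := Finset.exists_of_ssubset hX
    -- The summand x + 1, rather than x, makes a missing point 0 count.
    exact Finset.sum_lt_sum_of_subset hX.1 hy hyX (Nat.succ_pos _) fun _ _ _ => Nat.zero_le _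
  · push Not at hfix
    obtain ⟨x, hx, hxc⟩ := hfix
    refine lt_of_lt_of_le (Finset.sum_lt_sum (fun y hy => ?_) ⟨x, hx, ?_⟩) hle
    · exact Nat.succ_le_succ (hc y hy).1
    · exact Nat.succ_lt_succ ((hc x hx).1.lt_of_ne hxc.symm)

theorem extend_surjective : Function.Surjective (extend (n := n)) := by
  classical
  intro f
  -- X takes the greatest point of each fibre of `f` over a non-top value. Restricted to X, `f`
  -- becomes the θ whose extension is `f`.
  let X : Finset (Fin n) := {x | (∃ a, toPartial f x = some a) ∧
    ∀ y, toPartial f y = toPartial f x → y ≤ x}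
  have hX {x : Fin n} : x ∈ X ↔ (∃ a, toPartial f x = some a) ∧
      ∀ y, toPartial f y = toPartial f x → y ≤ x := by simp [X]
  obtain ⟨Y, hY⟩ : ∃ Y, CarriesFinset (toPartial f) X Y :=
    CarriesFinset.of_forall
      (fun x hx y hy e => le_antisymm ((hX.1 hy).2 x e) ((hX.1 hx).2 y e.symm))
      fun x hx => (hX.1 hx).1
  obtain ⟨θ, hd, -, hθ⟩ := ICMonoid.exists_restrict (isCatalanPartial f) hY
  refine ⟨θ, Subtype.ext (funext fun j => le_antisymm ?_ ?_)⟩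
  · by_cases hj : f.1 j = Fin.last n
    · exact hj ▸ Fin.le_last _
    · obtain ⟨a, ha⟩ := Fin.exists_castSucc_eq.2 hj
      have hjl : j ≠ Fin.last n := fun h => hj (h ▸ map_last f)
      obtain ⟨i, rfl⟩ := Fin.exists_castSucc_eq.2 hjl
      have hne : (Finset.univ.filter fun x => toPartial f x = toPartial f i).Nonempty :=
        ⟨i, by simp⟩
      obtain ⟨x, hx, hmax⟩ := Finset.exists_max_image _ id hne
      simp only [Finset.mem_filter, Finset.mem_univ, true_and, id] at hx hmax
      have hxa : toPartial f x = some a := hx.trans (toPartial_eq_some.2 ha.symm)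
      have hxX : x ∈ X := hX.2 ⟨⟨a, hxa⟩, fun y hy => hmax y (hy.trans hx)⟩
      rw [← ha]
      exact extend_le (Fin.castSucc_le_castSucc_iff.2 (hmax i rfl)) ((hθ x hxX).trans hxa)
  · rw [extend_apply]
    refine Finset.le_inf fun x hx => ?_
    simp only [Finset.mem_filter, Finset.mem_univ, true_and] at hx
    cases h : ICMonoid.toPartial θ x with
    | none => simpa using Fin.le_last _
    | some a =>
      have hxX : x ∈ X := hd ▸ ICMonoid.mem_dom.2 ⟨a, h⟩
      rw [finSuccEquivLast_symm_some, ← toPartial_eq_some.1 ((hθ x hxX).symm.trans h)]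
      exact f.2.1 _ _ hx

variable (k : Type*) [Field k]

/-- The representation of `CatalanMonoid (n + 1)` on the finite subsets of `Fin n`. -/
noncomputable def matrixHom :
    CatalanMonoid (n + 1) →* Matrix (Finset (Fin n)) (Finset (Fin n)) k where
  toFun f := partialMapMatrix k (toPartial f)
  map_one' := by rw [toPartial_one, partialMapMatrix_some]
  map_mul' f g := by rw [toPartial_mul, partialMapMatrix_bind]

theorem lift_matrixHom_injective_and_range_eq :
    Function.Injective (MonoidAlgebra.lift k _ (CatalanMonoid (n + 1)) (matrixHom k)) ∧
      LinearMap.range (MonoidAlgebra.lift k _ (CatalanMonoid (n + 1)) (matrixHom k)).toLinearMap =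
        Submodule.span k (Set.range (ICMonoid.matrixUnit (n := n) k)) := by
  refine MonoidAlgebra.injective_and_range_eq_span_of_unitriangular _ _
    (ICMonoid.linearIndependent_matrixUnit k) extend extend_surjective
    (fun θ => ∑ x ∈ ICMonoid.dom θ, (x.1 + 1)) fun θ => ?_
  rw [MonoidAlgebra.lift_of]
  exact ICMonoid.partialMapMatrix_sub_matrixUnit_mem k (isCatalanPartial (extend θ)) θ
    (fun _ => toPartial_extend θ) (fun X => ∑ x ∈ X, (x.1 + 1))
    fun X Y => sum_lt_of_carriesFinset_extend θ

end CatalanMonoid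

theorem mainTheorem8 (k : Type*) [Field k] (n : ℕ) :
    Nonempty (MonoidAlgebra k (CatalanMonoid (n + 1)) ≃ₐ[k] MonoidAlgebra k (ICMonoid n)) := by
  obtain ⟨hinj₁, hrange₁⟩ := CatalanMonoid.lift_matrixHom_injective_and_range_eq (n := n) k
  obtain ⟨hinj₂, hrange₂⟩ := ICMonoid.lift_matrixHom_injective_and_range_eq (n := n) k
  have hrange : (MonoidAlgebra.lift k _ _ (CatalanMonoid.matrixHom (n := n) k)).range =
      (MonoidAlgebra.lift k _ _ (ICMonoid.matrixHom (n := n) k)).range :=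
    SetLike.ext fun x => SetLike.ext_iff.1 (hrange₁.trans hrange₂.symm) x
  exact ⟨(AlgEquiv.ofInjective _ hinj₁).trans
    ((Subalgebra.equivOfEq _ _ hrange).trans (AlgEquiv.ofInjective _ hinj₂).symm)⟩
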